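/- Let $n\ge 3$, let $R=\mathbb C[x_1,\dots,x_n,y_1,\dots,y_n]$ be the coordinate ring of $\mathbb C^{2n}$, and for $1\le i,j\le n$ let $\Delta_{ij}=x_iy_j-x_jy_i$ be the $2\times 2$ minors of the generic matrix with rows $(x_1,\dots,x_n)$ and $(y_1,\dots,y_n)$. Let $$f=\prod_{1\le i<j\le n}\Delta_{ij},$$ the defining polynomial of the determinantal arrangement of the complete graph on $n$ vertices, and let $\mathrm{Der}(-\log f)$ be the $R$-module of all $\mathbb C$-derivations $\theta:R\to R$ with $\theta(f)\in (f)$. Then $f$ is a free divisor, that is, $f\neq 0$ and $\mathrm{Der}(-\log f)$ is a free $R$-module. More precisely, put $$\alpha=\sum_{k=1}^n x_k\frac{\partial}{\partial y_k},\qquad \beta=\sum_{k=1}^n y_k\frac{\partial}{\partial x_k},\qquad \gamma=\sum_{k=1}^n y_k\frac{\partial}{\partial y_k},\qquad \theta_k=x_k\frac{\partial}{\partial x_k}+y_k\frac{\partial}{\partial y_k}\quad(1\le k\le n),$$ and, for $0\le m\le n-4$, $$\varphi_m=\sum_{k=4}^n a_{m,k}\,\Delta_{2k}\Delta_{3k}\Big(x_1\frac{\partial}{\partial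 x_k}+y_1\frac{\partial}{\partial y_k}\Big),\qquad a_{m,k}=\sum_{\substack{S\subseteq T_k\\ |S|=m}}\ \prod_{j\in S}x_j\prod_{j\in T_k\setminus S}y_j,\qquad T_k=\{4,\dots,n\}\setminus\{k\}$$ (there is no $\varphi_m$ if $n=3$). Then the $2n$ derivations $\alpha,\beta,\gamma,\theta_1,\dots,\theta_n,\varphi_0,\dots,\varphi_{n-4}$ form a basis of the $R$-module $\mathrm{Der}(-\log f)$. The coefficients of $\alpha,\beta,\gamma$ and the $\theta_k$ are homogeneous of degree $1$, those of the $\varphi_m$ are homogeneous of degree $n+1$, and the determinant of the $2n\times 2n$ matrix of coefficients of these derivations with respect to the $\partial/\partial x_i$, $\partial/\partial y_i$, taken in some order, equals $c\,f$ for a nonzero constant $c\in\mathbb C$. -/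

import Mathlib

noncomputable section

namespace DetArr

/-- The coordinate ring `ℂ[x₁, …, xₙ, y₁, …, yₙ]` of `ℂ²ⁿ`; the left summand indexes the `xᵢ`,
the right one the `yᵢ`. Columns are numbered from `0`. -/
abbrev CoordRing (n : ℕ) : Type := MvPolynomial (Fin n ⊕ Fin n) ℂ

/-- The `R`-module of polynomial vector fields on `ℂ²ⁿ`. -/
abbrev VectorField (n : ℕ) : Type := Derivation ℂ (CoordRing n) (CoordRing n)

variable {n : ℕ}

/-- The entry `xᵢ` of the generic `2 × n` matrix. -/
def x (i : Fin n) : CoordRing n := MvPolynomial.X (Sum.inl i)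

/-- The entry `yᵢ` of the generic `2 × n` matrix. -/
def y (i : Fin n) : CoordRing n := MvPolynomial.X (Sum.inr i)

/-- The vector field `∂/∂xᵢ`. -/
def dx (i : Fin n) : VectorField n := MvPolynomial.pderiv (Sum.inl i)

/-- The vector field `∂/∂yᵢ`. -/
def dy (i : Fin n) : VectorField n := MvPolynomial.pderiv (Sum.inr i)

/-- The generic `2 × n` matrix, with rows `x` and `y`. -/
def genericMatrix (n : ℕ) : Matrix (Fin 2) (Fin n) (CoordRing n) := Matrix.of ![x, y]

/-- The `2`-minor `Δᵢⱼ = xᵢ yⱼ - xⱼ yᵢ` of the generic matrix on the columns `i`, `j`. -/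
def minor (i j : Fin n) : CoordRing n := ((genericMatrix n).submatrix id ![i, j]).det

/-- The defining polynomial of the determinantal arrangement of a graph on `n` vertices:
the product of the minors `Δᵢⱼ`, `i < j`, over the edges of the graph. -/
def arrangementPoly (G : SimpleGraph (Fin n)) [DecidableRel G.Adj] : CoordRing n :=
  ∏ p : Fin n × Fin n with p.1 < p.2 ∧ G.Adj p.1 p.2, minor p.1 p.2

/-- The module `Der(-log f)` of the vector fields `θ` with `θ(f) ∈ (f)`. -/
def logDer (f : CoordRing n) : Submodule (CoordRing n) (VectorField n) where
  carrier := {θ | θ f ∈ Ideal.span {f}}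
  add_mem' := fun ha hb => by
    simpa using Ideal.add_mem _ ha hb
  zero_mem' := by simp
  smul_mem' := fun c _ h => by
    simpa using Ideal.mul_mem_left _ c h

/-- The divisor of the nonzero polynomial `f` is free if `Der(-log f)` is a free module. -/
def IsFreeDivisor (f : CoordRing n) : Prop :=
  f ≠ 0 ∧ Module.Free (CoordRing n) (logDer f)

/-- A vector field all of whose coefficients are homogeneous polynomials of degree `d`. -/
def IsHomogeneousField (θ : VectorField n) (d : ℕ) : Prop :=
  ∀ v : Fin n ⊕ Fin n, (θ (MvPolynomial.X v)).IsHomogeneous d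

/-- `α = ∑ₖ xₖ ∂/∂yₖ`. -/
def α (n : ℕ) : VectorField n := ∑ k, x k • dy k

/-- `β = ∑ₖ yₖ ∂/∂xₖ`. -/
def β (n : ℕ) : VectorField n := ∑ k, y k • dx k

/-- `γ = ∑ₖ yₖ ∂/∂yₖ`. -/
def γ (n : ℕ) : VectorField n := ∑ k, y k • dy k

/-- The scaling `θₖ = xₖ ∂/∂xₖ + yₖ ∂/∂yₖ` of column `k`. -/
def θ (k : Fin n) : VectorField n := x k • dx k + y k • dy k

/-- The columns other than the first three and `k`. -/
def tailWithout (k : Fin n) : Finset (Fin n) := {j | 3 ≤ j.val ∧ j ≠ k}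

/-- The polynomial `a_{m,k}`: the sum, over the `m`-element sets `S` of columns other than the
first three and `k`, of the product of the `xⱼ`, `j ∈ S`, and of the `yⱼ`, `j ∉ S`, among these
columns. (In the sum over all orderings `j₁, …, j_{n-4}` of these columns of the monomials
`x_{j₁} ⋯ x_{jₘ} y_{jₘ₊₁} ⋯ y_{j_{n-4}}` each term occurs `m! (n-4-m)!` times.) -/
def a (m : ℕ) (k : Fin n) : CoordRing n :=
  ∑ S ∈ (tailWithout k).powersetCard m, (∏ j ∈ S, x j) * ∏ j ∈ tailWithout k \ S, y j

/-- `φₘ = ∑_{k ≥ 4} a_{m,k} Δ₂ₖ Δ₃ₖ (x₁ ∂/∂xₖ + y₁ ∂/∂yₖ)`, in the numbering of columns from `1`. -/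
def φ (hn : 3 ≤ n) (m : ℕ) : VectorField n :=
  ∑ k : Fin n with 3 ≤ k.val,
    (a m k * minor ⟨1, by omega⟩ k * minor ⟨2, by omega⟩ k) •
      (x (⟨0, by omega⟩ : Fin n) • dx k + y (⟨0, by omega⟩ : Fin n) • dy k)

/-- The `2n` vector fields `α, β, γ`, `θₖ` for all columns `k`, and `φ₀, …, φ_{n-4}`. -/
def basisField (hn : 3 ≤ n) : Fin 3 ⊕ Fin n ⊕ Fin (n - 3) → VectorField n :=
  Sum.elim ![α n, β n, γ n] (Sum.elim θ fun m => φ hn m.val)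

/-- The coefficient matrix of the fields `basisField hn`: the column of a field lists its
coefficients with respect to the `∂/∂xᵢ` and the `∂/∂yᵢ`. -/
def coeffMatrix (hn : 3 ≤ n) :
    Matrix (Fin n ⊕ Fin n) (Fin 3 ⊕ Fin n ⊕ Fin (n - 3)) (CoordRing n) :=
  Matrix.of fun v b => basisField hn b (MvPolynomial.X v)

end DetArr

end

/-!
Let `M` be the coefficient matrix of logarithmic fields for a squarefree `f`. If `p` is a prime
factor of `f`, the entries of `(∂p/∂v)ᵥ * M` are the values of the fields at `p`, hence divisible by
`p`; multiplying by the adjugate of `M` gives `p ∣ ∂p/∂v * det M` for every coordinate `v`, and so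
`p ∣ det M`. Thus `f ∣ det M`, and if `det M` is a unit times `f`, Cramer's rule writes every
logarithmic field as a combination of the given ones (Saito's criterion).

Here the degrees of the `2n` fields add up to `n(n - 1) = deg f`, so `det M` is a constant multiple
of `f`, and it remains to see that the fields are linearly independent. In a relation between them,
the first three columns, where the `φₘ` vanish, kill `α`, `β`, `γ`: their coefficients are those of
a binary quadratic form with three zeros. In a column `k > 3`, the relation is one between the
independent vectors `(xₖ, yₖ)` and `(x₁, y₁)`, which kills `θₖ` and leaves a linear system for the
coefficients of the `φₘ` whose matrix `(a_{m,k})` is diagonalized by a Vandermonde matrix.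
-/

noncomputable section

namespace Saito

open MvPolynomial Matrix

section Derivation

variable {R A : Type*} [CommSemiring R] [CommSemiring A] [Algebra R A]

theorem prod_dvd_derivation_prod {ι : Type*} {s : Finset ι} {g : ι → A} {D : Derivation R A A}
    (h : ∀ i ∈ s, g i ∣ D (g i)) : ∏ i ∈ s, g i ∣ D (∏ i ∈ s, g i) := by
  induction s using Finset.cons_induction with
  | empty => simp
  | cons i s hi ih =>
    rw [Finset.forall_mem_cons] at h
    rw [Finset.prod_cons, Derivation.leibniz, smul_eq_mul, smul_eq_mul]
    refine dvd_add (mul_dvd_mul_left _ (ih h.2)) ?_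
    rw [mul_comm]
    exact mul_dvd_mul_left _ h.1

theorem sum_derivation_apply {ι : Type*} (s : Finset ι) (D : ι → Derivation R A A) (p : A) :
    (∑ i ∈ s, D i) p = ∑ i ∈ s, D i p := by
  rw [← Derivation.coeFnAddMonoidHom_apply, map_sum, Finset.sum_apply]
  rfl

end Derivation

theorem dvd_derivation_of_squarefree_of_prime {R A : Type*} [CommSemiring R] [CommRing A]
    [Algebra R A] {D : Derivation R A A} {f p : A} (hf : Squarefree f) (hp : Prime p) (hpf : p ∣ f)
    (hD : f ∣ D f) : p ∣ D p := by
  obtain ⟨g, rfl⟩ := hpf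
  have hpg : ¬ p ∣ g := fun h => hp.not_isUnit (hf p (mul_dvd_mul_left p h))
  rw [Derivation.leibniz, smul_eq_mul, smul_eq_mul] at hD
  have hgDp : p ∣ g * D p := (dvd_add_right (dvd_mul_right _ _)).1 (dvd_of_mul_right_dvd hD)
  exact (hp.dvd_or_dvd hgDp).resolve_left hpg

theorem dvd_of_squarefree_of_forall_prime_dvd {A : Type*} [CommMonoidWithZero A]
    [UniqueFactorizationMonoid A] {f g : A} (hf : Squarefree f)
    (h : ∀ p, Prime p → p ∣ f → p ∣ g) : f ∣ g := by
  nontriviality A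
  induction f using UniqueFactorizationMonoid.induction_on_prime with
  | h₁ => exact absurd hf not_squarefree_zero
  | h₂ u hu => exact hu.dvd
  | h₃ f p _ hp ih =>
    refine (IsRelPrime.of_squarefree_mul hf).mul_dvd (h p hp (dvd_mul_right p f)) ?_
    exact ih hf.of_mul_right fun q hq hqf => h q hq (hqf.mul_left p)

section Coefficients

variable {σ ι R : Type*} [CommSemiring R]

/-- The `MvPolynomial σ R`-linear map that sends a vector field `∑ v, p v • ∂/∂v` to the vector
`p` of its coefficients. -/
def coefficients : Derivation R (MvPolynomial σ R) (MvPolynomial σ R) →ₗ[MvPolynomial σ R]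
    (σ → MvPolynomial σ R) where
  toFun D v := D (X v)
  map_add' _ _ := rfl
  map_smul' _ _ := rfl

theorem coefficients_injective : Function.Injective (coefficients (σ := σ) (R := R)) :=
  fun _ _ h => derivation_ext (congrFun h)

/-- The matrix whose columns are the coefficient vectors of a family of vector fields. -/
def coefficientMatrix (D : ι → Derivation R (MvPolynomial σ R) (MvPolynomial σ R)) :
    Matrix σ ι (MvPolynomial σ R) :=
  .of fun v i => D i (X v)

theorem coefficients_sum_smul [Fintype ι]
    (D : ι → Derivation R (MvPolynomial σ R) (MvPolynomial σ R)) (g : ι → MvPolynomial σ R) :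
    coefficients (∑ i, g i • D i) = coefficientMatrix D *ᵥ g := by
  ext1 v
  simp [coefficientMatrix, mulVec, dotProduct, coefficients, mul_comm]

theorem vecMul_pderiv_coefficientMatrix [Fintype σ]
    (D : ι → Derivation R (MvPolynomial σ R) (MvPolynomial σ R)) (p : MvPolynomial σ R) :
    (fun v => pderiv v p) ᵥ* coefficientMatrix D = fun i => D i p := by
  classical
  funext i
  have hD : D i = ∑ v, D i (X v) • pderiv v :=
    derivation_ext fun w => by simp [sum_derivation_apply, pderiv_X, Pi.single_apply]
  conv_rhs => rw [hD, sum_derivation_apply]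
  simp [vecMul, dotProduct, coefficientMatrix, mul_comm]

end Coefficients

section Determinant

variable {σ R : Type*} [CommRing R] [Fintype σ] [DecidableEq σ]

theorem det_coefficientMatrix_ne_zero [IsDomain R]
    {D : σ → Derivation R (MvPolynomial σ R) (MvPolynomial σ R)}
    (hD : LinearIndependent (MvPolynomial σ R) D) : (coefficientMatrix D).det ≠ 0 := by
  intro h0
  obtain ⟨g, hg, hMg⟩ := exists_mulVec_eq_zero_iff.2 h0
  rw [← coefficients_sum_smul, map_eq_zero_iff _ coefficients_injective] at hMg
  exact hg (funext (Fintype.linearIndependent_iff.1 hD g hMg))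

theorem isHomogeneous_det {ι : Type*} {M : Matrix σ σ (MvPolynomial ι R)} {d : σ → ℕ}
    (hM : ∀ i j, (M i j).IsHomogeneous (d j)) : M.det.IsHomogeneous (∑ j, d j) := by
  rw [det_apply]
  refine IsHomogeneous.sum _ _ _ fun τ _ => ?_
  rw [Units.smul_def, ← mem_homogeneousSubmodule]
  exact zsmul_mem ((mem_homogeneousSubmodule _ _).2 <| .prod _ _ _ fun i _ => hM (τ i) i) _

end Determinant

theorem not_dvd_pderiv_of_mem_vars {σ R : Type*} [CommRing R] [IsDomain R] [CharZero R]
    {p : MvPolynomial σ R} {v : σ} (hv : v ∈ p.vars) : ¬ p ∣ pderiv v p := by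
  obtain ⟨m, hm, hmv⟩ := (mem_vars_iff_mem_support v).1 hv
  have hmv1 : Finsupp.single v 1 ≤ m := by
    simpa [Finsupp.single_le_iff, Nat.one_le_iff_ne_zero] using hmv
  have hpderiv : pderiv v p ≠ 0 := fun h0 => by
    have := coeff_pderiv (i := v) p (m - Finsupp.single v 1)
    rw [h0, coeff_zero, tsub_add_cancel_of_le hmv1] at this
    exact mul_ne_zero (mem_support_iff.1 hm) (Nat.cast_add_one_ne_zero _) this.symm
  have hlt : degreeOf v (pderiv v p) < degreeOf v p := by
    have hpos : 0 < degreeOf v p := (Nat.pos_of_ne_zero (by simpa using hmv)).trans_le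
      (monomial_le_degreeOf v hm)
    refine (degreeOf_lt_iff hpos).2 fun k hk => ?_
    rw [mem_support_iff, coeff_pderiv] at hk
    simpa using monomial_le_degreeOf v (mem_support_iff.2 (left_ne_zero_of_mul hk))
  rintro ⟨q, hq⟩
  rw [hq] at hlt hpderiv
  rw [degreeOf_mul_eq (left_ne_zero_of_mul hpderiv) (right_ne_zero_of_mul hpderiv)] at hlt
  omega

theorem exists_not_dvd_pderiv {σ K : Type*} [Field K] [CharZero K] {p : MvPolynomial σ K}
    (hp : Irreducible p) : ∃ v, ¬ p ∣ pderiv v p := by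
  have hvars : p.vars.Nonempty := by
    rw [Finset.nonempty_iff_ne_empty, Ne, vars_eq_empty_iff_eq_C]
    intro hC
    refine hp.not_isUnit ?_
    rw [hC]
    refine (isUnit_iff_ne_zero.2 fun h0 => hp.ne_zero ?_).map C
    rw [hC, h0, C_0]
  exact hvars.imp fun v hv => not_dvd_pderiv_of_mem_vars hv

theorem exists_eq_C_mul_of_dvd {σ R : Type*} [CommRing R] [IsDomain R] {f g : MvPolynomial σ R}
    {d : ℕ} (hf : f.IsHomogeneous d) (hg : g.IsHomogeneous d) (hg0 : g ≠ 0) (hfg : f ∣ g) :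
    ∃ c : R, c ≠ 0 ∧ g = C c * f := by
  obtain ⟨q, rfl⟩ := hfg
  obtain ⟨hf0, hq0⟩ := ne_zero_and_ne_zero_of_mul hg0
  have hq : q.totalDegree = 0 := by
    have := hg.totalDegree hg0
    rw [totalDegree_mul_of_isDomain hf0 hq0, hf.totalDegree hf0] at this
    omega
  rw [totalDegree_eq_zero_iff_eq_C] at hq
  refine ⟨coeff 0 q, fun h0 => hq0 ?_, ?_⟩
  · rw [hq, h0, C_0]
  · rw [← hq, mul_comm]

section Criterion

variable {σ K : Type*} [Fintype σ] [DecidableEq σ] [Field K] [CharZero K]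
  {f : MvPolynomial σ K} {D : σ → Derivation K (MvPolynomial σ K) (MvPolynomial σ K)}

-- A prime factor `p` of `f` divides every entry of `(∂p/∂v)ᵥ * M`, hence, by multiplication with
-- the adjugate of `M`, every product `∂p/∂v * det M`.
theorem dvd_det_coefficientMatrix (hf : Squarefree f) (hD : ∀ i, f ∣ D i f) :
    f ∣ (coefficientMatrix D).det := by
  refine dvd_of_squarefree_of_forall_prime_dvd hf fun p hp hpf => ?_
  obtain ⟨v, hv⟩ := exists_not_dvd_pderiv hp.irreducible
  set M := coefficientMatrix D
  have hadj : ((fun i => D i p) ᵥ* M.adjugate) v = pderiv v p * M.det := by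
    rw [← vecMul_pderiv_coefficientMatrix, vecMul_vecMul, mul_adjugate, vecMul_smul, vecMul_one,
      Pi.smul_apply, smul_eq_mul, mul_comm]
  have hdvd : p ∣ pderiv v p * M.det := by
    rw [← hadj]
    exact Finset.dvd_sum fun i _ =>
      (dvd_derivation_of_squarefree_of_prime hf hp hpf (hD i)).mul_right _
  exact (hp.dvd_or_dvd hdvd).resolve_left hv

-- By Cramer's rule: replacing one of the `D i` by `δ` leaves all fields logarithmic, so `f` divides
-- the determinants that express `u * f • δ` through the `D i`.
theorem mem_span_range_of_det_eq_mul (hf : Squarefree f) (hD : ∀ i, f ∣ D i f)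
    {u : MvPolynomial σ K} (hu : IsUnit u) (hdet : (coefficientMatrix D).det = u * f)
    {δ : Derivation K (MvPolynomial σ K) (MvPolynomial σ K)} (hδ : f ∣ δ f) :
    δ ∈ Submodule.span (MvPolynomial σ K) (Set.range D) := by
  have hcramer (i : σ) : f ∣ (coefficientMatrix D).cramer (coefficients δ) i := by
    have hupdate : (coefficientMatrix D).updateCol i (coefficients δ) =
        coefficientMatrix (Function.update D i δ) := by
      ext1 v j
      obtain rfl | hji := eq_or_ne j i <;> simp [coefficientMatrix, coefficients, *]
    rw [cramer_apply, hupdate]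
    refine dvd_det_coefficientMatrix hf fun j => ?_
    obtain rfl | hji := eq_or_ne j i <;> simp [*]
  choose q hq using hcramer
  have hδq : u • δ = ∑ i, q i • D i := by
    refine coefficients_injective (smul_right_injective _ hf.ne_zero ?_)
    have := mulVec_cramer (coefficientMatrix D) (coefficients δ)
    rw [show cramer _ _ = f • q from funext hq, mulVec_smul, hdet, mul_comm, mul_smul] at this
    simpa only [coefficients_sum_smul, map_smul] using this.symm
  rw [← Submodule.smul_mem_iff_of_isUnit _ hu, hδq]
  exact Submodule.sum_smul_mem _ _ fun i _ => Submodule.subset_span (Set.mem_range_self i)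

theorem exists_det_coefficientMatrix_eq_C_mul {d : σ → ℕ} (hf : Squarefree f)
    (hD : ∀ i, f ∣ D i f) (hli : LinearIndependent (MvPolynomial σ K) D)
    (hdeg : ∀ i v, (D i (X v)).IsHomogeneous (d i)) (hfdeg : f.IsHomogeneous (∑ i, d i)) :
    ∃ c : K, c ≠ 0 ∧ (coefficientMatrix D).det = C c * f :=
  exists_eq_C_mul_of_dvd hfdeg (isHomogeneous_det fun v i => hdeg i v)
    (det_coefficientMatrix_ne_zero hli) (dvd_det_coefficientMatrix hf hD)

end Criterion

theorem exists_basis_of_span_eq {ι R M : Type*} [Semiring R] [AddCommMonoid M] [Module R M]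
    {v : ι → M} {N : Submodule R M} (hv : LinearIndependent R v)
    (hN : Submodule.span R (Set.range v) = N) :
    ∃ b : Module.Basis ι R N, ∀ i, (b i : M) = v i := by
  subst hN
  exact ⟨.span hv, fun i => congrArg Subtype.val (Module.Basis.span_apply hv i)⟩

end Saito

section LinearProduct

open Polynomial

variable {R ι : Type*} [CommSemiring R]

/-- The polynomial `∏ j ∈ T, (x j * X + y j)`, the generating function in the variable `X` of the
sums over the subsets `S ⊆ T` of a given cardinality of `∏ j ∈ S, x j * ∏ j ∈ T \ S, y j`. -/
def linearProd (x y : ι → R) (T : Finset ι) : R[X] :=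
  ∏ j ∈ T, (C (x j) * X + C (y j))

theorem coeff_linearProd [DecidableEq ι] (x y : ι → R) (T : Finset ι) (m : ℕ) :
    (linearProd x y T).coeff m =
      ∑ S ∈ T.powersetCard m, (∏ j ∈ S, x j) * ∏ j ∈ T \ S, y j := by
  simp only [linearProd, Finset.prod_add, Finset.prod_mul_distrib, Finset.prod_const, ← map_prod,
    finsetSum_coeff, coeff_mul_C, coeff_C_mul_X_pow, ite_mul, zero_mul, ← Finset.sum_filter,
    Finset.powersetCard_eq_filter, eq_comm]

theorem linearProd_map {κ : Type*} (x y : ι → R) (e : κ ↪ ι) (T : Finset κ) :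
    linearProd x y (T.map e) = linearProd (x ∘ e) (y ∘ e) T :=
  Finset.prod_map ..

theorem coeff_linearProd_insert [DecidableEq ι] (x y : ι → R) {T : Finset ι} {j : ι} (hj : j ∉ T)
    (m : ℕ) : (linearProd x y (insert j T)).coeff m =
      x j * (X * linearProd x y T).coeff m + y j * (linearProd x y T).coeff m := by
  rw [linearProd, Finset.prod_insert hj, add_mul, mul_assoc, coeff_add, coeff_C_mul, coeff_C_mul,
    linearProd]

theorem sum_coeff_linearProd_mul (x y : ι → R) (T : Finset ι) (s t : R) :
    ∑ m ∈ Finset.range (T.card + 1), (linearProd x y T).coeff m * (s ^ m * t ^ (T.card - m)) =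
      ∏ j ∈ T, (x j * s + y j * t) := by
  classical
  rw [Finset.prod_add, Finset.sum_powerset]
  refine Finset.sum_congr rfl fun m _ => ?_
  rw [coeff_linearProd, Finset.sum_mul]
  refine Finset.sum_congr rfl fun S hS => ?_
  obtain ⟨hST, rfl⟩ := Finset.mem_powersetCard.1 hS
  rw [Finset.prod_mul_distrib, Finset.prod_mul_distrib, Finset.prod_const, Finset.prod_const,
    Finset.card_sdiff_of_subset hST]
  ring

end LinearProduct

section Vandermonde

variable {R : Type*} [CommRing R] {N : ℕ}

theorem eq_zero_of_forall_sum_mul_pow_mul_pow_rev_eq_zero [IsDomain R] {x y : Fin N → R}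
    (hxy : Pairwise fun k l => x k * y l - x l * y k ≠ 0) {c : Fin N → R}
    (hc : ∀ k, ∑ m : Fin N, c m * (x k ^ m.val * y k ^ m.rev.val) = 0) : c = 0 := by
  have hdet : (Matrix.projVandermonde x y).det ≠ 0 := by
    rw [Matrix.det_projVandermonde]
    exact Finset.prod_ne_zero_iff.2 fun k _ => Finset.prod_ne_zero_iff.2 fun l hl =>
      hxy (Finset.mem_Ioi.1 hl).ne'
  refine Matrix.eq_zero_of_mulVec_eq_zero hdet (funext fun k => ?_)
  exact (Finset.sum_congr rfl fun m _ => mul_comm _ _).trans (hc k)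

/-- The square matrix whose row `k` lists the coefficients of the product `linearProd x y` over all
indices but `k`. -/
def linearProdMatrix (x y : Fin N → R) : Matrix (Fin N) (Fin N) R :=
  .of fun k m => (linearProd x y (Finset.univ.erase k)).coeff m

-- Row `k` against column `l` evaluates the form `∏ j ≠ k, (x j * s + y j * t)` at
-- `(s, t) = (-y l, x l)`, the zero of its `l`-th factor.
theorem linearProdMatrix_mul_projVandermonde_transpose (x y : Fin N → R) :
    linearProdMatrix x y * (Matrix.projVandermonde (-y) x).transpose =
      .diagonal fun k => ∏ l ∈ Finset.univ.erase k, (x k * y l - x l * y k) := by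
  ext1 k l
  have hcard : (Finset.univ.erase k).card + 1 = N := by
    rw [Finset.card_erase_add_one (Finset.mem_univ k), Finset.card_fin]
  have heval : (linearProdMatrix x y * (Matrix.projVandermonde (-y) x).transpose) k l =
      ∏ j ∈ Finset.univ.erase k, (x l * y j - x j * y l) := by
    trans ∏ j ∈ Finset.univ.erase k, (x j * -y l + y j * x l)
    · rw [← sum_coeff_linearProd_mul, hcard, ← Fin.sum_univ_eq_sum_range (fun m =>
        (linearProd x y (Finset.univ.erase k)).coeff m * _), Matrix.mul_apply]
      refine Finset.sum_congr rfl fun m _ => ?_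
      rw [Matrix.transpose_apply, Matrix.projVandermonde_apply, Fin.val_rev, Pi.neg_apply,
        show N - (m + 1) = (Finset.univ.erase k).card - m by omega]
      rfl
    · exact Finset.prod_congr rfl fun j _ => by ring
  rw [heval]
  obtain rfl | hkl := eq_or_ne k l
  · rw [Matrix.diagonal_apply_eq]
  · rw [Matrix.diagonal_apply_ne _ hkl]
    exact Finset.prod_eq_zero (Finset.mem_erase.2 ⟨hkl.symm, Finset.mem_univ l⟩) (sub_self _)

theorem det_linearProdMatrix_ne_zero [IsDomain R] {x y : Fin N → R}
    (hxy : Pairwise fun k l => x k * y l - x l * y k ≠ 0) : (linearProdMatrix x y).det ≠ 0 := by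
  refine left_ne_zero_of_mul (b := (Matrix.projVandermonde (-y) x).transpose.det) ?_
  rw [← Matrix.det_mul, linearProdMatrix_mul_projVandermonde_transpose, Matrix.det_diagonal]
  exact Finset.prod_ne_zero_iff.2 fun k _ => Finset.prod_ne_zero_iff.2 fun l hl =>
    hxy (Finset.ne_of_mem_erase hl).symm

end Vandermonde

namespace DetArr

open MvPolynomial

variable {n : ℕ}

section Minors

theorem minor_eq (i j : Fin n) : minor i j = x i * y j - x j * y i := by
  simp [minor, genericMatrix, Matrix.det_fin_two]

theorem isHomogeneous_x (i : Fin n) : (x i).IsHomogeneous 1 := isHomogeneous_X _ _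

theorem isHomogeneous_y (i : Fin n) : (y i).IsHomogeneous 1 := isHomogeneous_X _ _

theorem isHomogeneous_minor (i j : Fin n) : (minor i j).IsHomogeneous 2 := by
  rw [minor_eq]
  exact ((isHomogeneous_x i).mul (isHomogeneous_y j)).sub
    ((isHomogeneous_x j).mul (isHomogeneous_y i))

theorem prime_minor {i j : Fin n} (hij : i ≠ j) : Prime (minor i j) := by
  have hlinear : minor i j = y j * X (Sum.inl i) + -(x j * y i) := by
    rw [minor_eq, x, x, y, y]
    ring
  have hcoprime : IsRelPrime (y j) (-(x j * y i)) := by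
    have hp : Prime (y j) := X_prime
    rw [hp.irreducible.isRelPrime_iff_not_dvd, dvd_neg, hp.dvd_mul]
    simp [x, y, X_dvd_X, hij.symm]
  rw [← UniqueFactorizationMonoid.irreducible_iff_prime, hlinear]
  refine irreducible_mul_X_add _ _ _ (X_ne_zero _) ?_ ?_ hcoprime
  · simp [y, vars_X]
  · rw [vars_neg]
    intro hmem
    have := vars_mul _ _ hmem
    simp [x, y, vars_X, hij] at this

theorem minor_ne_zero {i j : Fin n} (hij : i ≠ j) : minor i j ≠ 0 := (prime_minor hij).ne_zero

theorem x_ne_zero (i : Fin n) : x i ≠ 0 := X_ne_zero _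

/-- The point of `ℂ²ⁿ` with `xₖ = 1` and `yₗ = 1` and all other coordinates zero, at which `Δₖₗ`
is the only nonzero minor. -/
def unitPoint (k l : Fin n) : Fin n ⊕ Fin n → ℂ :=
  Sum.elim (Pi.single k 1) (Pi.single l 1)

theorem eval_unitPoint_minor (k l i j : Fin n) :
    eval (unitPoint k l) (minor i j) =
      (if i = k ∧ j = l then 1 else 0) - if j = k ∧ i = l then 1 else 0 := by
  simp [minor_eq, x, y, unitPoint, Pi.single_apply, ← ite_and, and_comm]

theorem isRelPrime_minor {i j k l : Fin n} (hij : i < j) (hkl : k < l) (h : (i, j) ≠ (k, l)) :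
    IsRelPrime (minor i j) (minor k l) := by
  rw [(prime_minor hij.ne).irreducible.isRelPrime_iff_not_dvd]
  intro hdvd
  have heval := map_dvd (eval (unitPoint k l)) hdvd
  have hne : ¬ (i = k ∧ j = l) := by simpa using h
  have hne' : ¬ (j = k ∧ i = l) := fun ⟨hjk, hil⟩ => (hjk ▸ hil ▸ hij).asymm hkl
  have hlk : ¬ (l = k ∧ k = l) := fun hlk => hkl.ne hlk.2
  rw [eval_unitPoint_minor, eval_unitPoint_minor, if_neg hne, if_neg hne', if_neg hlk] at heval
  simp at heval

theorem derivation_minor (D : VectorField n) (i j : Fin n) :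
    D (minor i j) = x i * D (y j) + y j * D (x i) - (x j * D (y i) + y i * D (x j)) := by
  simp [minor_eq]

theorem eq_zero_of_mul_add_mul_eq_zero {i j : Fin n} (hij : i ≠ j) {s t : CoordRing n}
    (hx : s * x i + t * x j = 0) (hy : s * y i + t * y j = 0) : s = 0 ∧ t = 0 := by
  refine ⟨(mul_eq_zero_iff_right (minor_ne_zero hij)).1 ?_,
    (mul_eq_zero_iff_right (minor_ne_zero hij)).1 ?_⟩
  · rw [minor_eq]
    linear_combination y j * hx - x j * hy
  · rw [minor_eq]
    linear_combination x i * hy - y i * hx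

end Minors

section ArrangementPoly

variable (G : SimpleGraph (Fin n)) [DecidableRel G.Adj]

theorem squarefree_arrangementPoly : Squarefree (arrangementPoly G) := by
  refine Finset.squarefree_prod_of_pairwise_isCoprime (fun p hp q hq hpq => ?_) fun p hp => ?_
  · rw [Finset.mem_coe, Finset.mem_filter] at hp hq
    exact isRelPrime_minor hp.2.1 hq.2.1 hpq
  · exact (prime_minor (Finset.mem_filter.1 hp).2.1.ne).irreducible.squarefree

theorem card_filter_lt_mul_two (n : ℕ) :
    ({p | p.1 < p.2} : Finset (Fin n × Fin n)).card * 2 = n * (n - 1) := by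
  rw [← Finset.sum_range_id_mul_two, Finset.card_filter, Fintype.sum_prod_type_right,
    ← Fin.sum_univ_eq_sum_range]
  congr! with j
  rw [← Finset.card_filter, Finset.filter_gt_eq_Iio, Fin.card_Iio]

theorem isHomogeneous_arrangementPoly_top :
    (arrangementPoly (⊤ : SimpleGraph (Fin n))).IsHomogeneous (n * (n - 1)) := by
  have htop (p : Fin n × Fin n) : p.1 < p.2 ∧ (⊤ : SimpleGraph (Fin n)).Adj p.1 p.2 ↔ p.1 < p.2 :=
    and_iff_left_of_imp LT.lt.ne
  simp only [arrangementPoly, htop]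
  rw [← card_filter_lt_mul_two, ← smul_eq_mul, ← Finset.sum_const]
  exact IsHomogeneous.prod _ _ _ fun p _ => isHomogeneous_minor p.1 p.2

theorem mem_logDer {f : CoordRing n} {D : VectorField n} : D ∈ logDer f ↔ f ∣ D f :=
  Ideal.mem_span_singleton

theorem mem_logDer_arrangementPoly_of_forall {D : VectorField n}
    (hD : ∀ i j, i < j → G.Adj i j → minor i j ∣ D (minor i j)) :
    D ∈ logDer (arrangementPoly G) :=
  mem_logDer.2 <| Saito.prod_dvd_derivation_prod fun p hp =>
    hD p.1 p.2 (Finset.mem_filter.1 hp).2.1 (Finset.mem_filter.1 hp).2.2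

end ArrangementPoly

section LinearFields

@[simp] theorem dx_x (i j : Fin n) : dx i (x j) = if j = i then 1 else 0 := by
  simp [dx, x, pderiv_X, Pi.single_apply]

@[simp] theorem dx_y (i j : Fin n) : dx i (y j) = 0 := by simp [dx, y, pderiv_X]

@[simp] theorem dy_x (i j : Fin n) : dy i (x j) = 0 := by simp [dy, x, pderiv_X]

@[simp] theorem dy_y (i j : Fin n) : dy i (y j) = if j = i then 1 else 0 := by
  simp [dy, y, pderiv_X, Pi.single_apply]

@[simp] theorem α_x (k : Fin n) : α n (x k) = 0 := by simp [α, Saito.sum_derivation_apply]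

@[simp] theorem α_y (k : Fin n) : α n (y k) = x k := by simp [α, Saito.sum_derivation_apply]

@[simp] theorem β_x (k : Fin n) : β n (x k) = y k := by simp [β, Saito.sum_derivation_apply]

@[simp] theorem β_y (k : Fin n) : β n (y k) = 0 := by simp [β, Saito.sum_derivation_apply]

@[simp] theorem γ_x (k : Fin n) : γ n (x k) = 0 := by simp [γ, Saito.sum_derivation_apply]

@[simp] theorem γ_y (k : Fin n) : γ n (y k) = y k := by simp [γ, Saito.sum_derivation_apply]

@[simp] theorem θ_x (k l : Fin n) : θ k (x l) = if l = k then x l else 0 := by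
  by_cases h : l = k <;> simp [θ, h]

@[simp] theorem θ_y (k l : Fin n) : θ k (y l) = if l = k then y l else 0 := by
  by_cases h : l = k <;> simp [θ, h]

theorem α_minor (i j : Fin n) : α n (minor i j) = 0 := by
  simp [derivation_minor, mul_comm]

theorem β_minor (i j : Fin n) : β n (minor i j) = 0 := by
  simp [derivation_minor, mul_comm]

theorem γ_minor (i j : Fin n) : γ n (minor i j) = minor i j := by
  simp [minor_eq]

theorem θ_minor (k i j : Fin n) :
    θ k (minor i j) = minor i j * ((if i = k then 1 else 0) + if j = k then 1 else 0) := by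
  rw [derivation_minor, θ_x, θ_x, θ_y, θ_y, minor_eq]
  split_ifs <;> ring

theorem isHomogeneousField_iff {D : VectorField n} {d : ℕ} :
    IsHomogeneousField D d ↔ ∀ k, (D (x k)).IsHomogeneous d ∧ (D (y k)).IsHomogeneous d :=
  Sum.forall.trans forall_and.symm

theorem isHomogeneousField_α : IsHomogeneousField (α n) 1 :=
  isHomogeneousField_iff.2 fun k => by simpa [isHomogeneous_zero] using isHomogeneous_x k

theorem isHomogeneousField_β : IsHomogeneousField (β n) 1 :=
  isHomogeneousField_iff.2 fun k => by simpa [isHomogeneous_zero] using isHomogeneous_y k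

theorem isHomogeneousField_γ : IsHomogeneousField (γ n) 1 :=
  isHomogeneousField_iff.2 fun k => by simpa [isHomogeneous_zero] using isHomogeneous_y k

theorem isHomogeneousField_θ (k : Fin n) : IsHomogeneousField (θ k) 1 :=
  isHomogeneousField_iff.2 fun l => by
    obtain rfl | hlk := eq_or_ne l k
    · simpa using ⟨isHomogeneous_x l, isHomogeneous_y l⟩
    · simp [hlk, isHomogeneous_zero]

end LinearFields

section Phi

variable (hn : 3 ≤ n)

/-- The first three columns. -/
def headColumn : Fin 3 ↪ Fin n := Fin.castLEEmb hn

/-- The columns after the first three, `k ↦ k + 3`. -/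
def tailColumn : Fin (n - 3) ↪ Fin n :=
  (Fin.natAddEmb 3).trans (finCongr (Nat.add_sub_cancel' hn)).toEmbedding

theorem headColumn_lt (i : Fin 3) : (headColumn hn i).val < 3 := i.isLt

theorem three_le_tailColumn (k : Fin (n - 3)) : 3 ≤ (tailColumn hn k).val :=
  Nat.le_add_right 3 k.val

theorem headColumn_ne_tailColumn (i : Fin 3) (k : Fin (n - 3)) :
    headColumn hn i ≠ tailColumn hn k := fun h =>
  (h ▸ headColumn_lt hn i).not_ge (three_le_tailColumn hn k)

theorem eq_headColumn_or_eq_tailColumn (k : Fin n) :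
    (∃ i, headColumn hn i = k) ∨ ∃ j, tailColumn hn j = k := by
  obtain hk | hk := lt_or_ge k.val 3
  · exact .inl ⟨⟨k, hk⟩, rfl⟩
  · exact .inr ⟨⟨k - 3, by omega⟩, Fin.ext (Nat.add_sub_cancel' hk)⟩

theorem tailWithout_tailColumn (k : Fin (n - 3)) :
    tailWithout (tailColumn hn k) = (Finset.univ.erase k).map (tailColumn hn) := by
  ext j
  obtain ⟨i, rfl⟩ | ⟨l, rfl⟩ := eq_headColumn_or_eq_tailColumn hn j
  · simp [tailWithout, (headColumn_lt hn i).not_ge, (headColumn_ne_tailColumn hn i _).symm]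
  · simp [tailWithout, three_le_tailColumn]

theorem a_tailColumn (m : ℕ) (k : Fin (n - 3)) :
    a m (tailColumn hn k) =
      (linearProd (x ∘ tailColumn hn) (y ∘ tailColumn hn) (Finset.univ.erase k)).coeff m := by
  rw [← linearProd_map, coeff_linearProd, ← tailWithout_tailColumn, a]

theorem isHomogeneous_a (m : ℕ) (k : Fin n) : (a m k).IsHomogeneous (tailWithout k).card := by
  refine IsHomogeneous.sum _ _ _ fun S hS => ?_
  have hx := IsHomogeneous.prod S x 1 fun j _ => isHomogeneous_x j
  have hy := IsHomogeneous.prod (tailWithout k \ S) y 1 fun j _ => isHomogeneous_y j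
  convert hx.mul hy
  rw [← Finset.card_sdiff_add_card_eq_card (Finset.mem_powersetCard.1 hS).1, add_comm]
  simp

/-- The coefficient of `x₁ ∂/∂xₖ + y₁ ∂/∂yₖ` (columns numbered from `1`) in the field `φₘ`. -/
def φCoeff (m : ℕ) (k : Fin n) : CoordRing n :=
  if 3 ≤ k.val then a m k * minor (headColumn hn 1) k * minor (headColumn hn 2) k else 0

@[simp] theorem φCoeff_headColumn (m : ℕ) (i : Fin 3) : φCoeff hn m (headColumn hn i) = 0 :=
  if_neg (headColumn_lt hn i).not_ge

theorem φCoeff_tailColumn (m : ℕ) (k : Fin (n - 3)) :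
    φCoeff hn m (tailColumn hn k) = a m (tailColumn hn k) *
      minor (headColumn hn 1) (tailColumn hn k) * minor (headColumn hn 2) (tailColumn hn k) :=
  if_pos (three_le_tailColumn hn k)

theorem φ_eq_sum (m : ℕ) :
    φ hn m = ∑ k, φCoeff hn m k • (x (headColumn hn 0) • dx k + y (headColumn hn 0) • dy k) := by
  simp only [φCoeff, ite_smul, zero_smul, ← Finset.sum_filter]
  rfl

theorem φ_x (m : ℕ) (k : Fin n) : φ hn m (x k) = φCoeff hn m k * x (headColumn hn 0) := by
  simp [φ_eq_sum, Saito.sum_derivation_apply]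

theorem φ_y (m : ℕ) (k : Fin n) : φ hn m (y k) = φCoeff hn m k * y (headColumn hn 0) := by
  simp [φ_eq_sum, Saito.sum_derivation_apply]

theorem φ_minor (m : ℕ) (i j : Fin n) :
    φ hn m (minor i j) = φCoeff hn m i * minor (headColumn hn 0) j -
      φCoeff hn m j * minor (headColumn hn 0) i := by
  rw [derivation_minor, φ_x, φ_x, φ_y, φ_y, minor_eq, minor_eq]
  ring

theorem minor_headColumn_dvd_φ_minor (m : ℕ) (i : Fin 3) (j : Fin (n - 3)) :
    minor (headColumn hn i) (tailColumn hn j) ∣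
      φ hn m (minor (headColumn hn i) (tailColumn hn j)) := by
  rw [φ_minor, φCoeff_headColumn, zero_mul, zero_sub, dvd_neg, φCoeff_tailColumn]
  fin_cases i
  · simp [minor_eq]
  · exact ((dvd_mul_left _ _).mul_right _).mul_right _
  · exact (dvd_mul_left _ _).mul_right _

theorem exists_a_tailColumn_eq (m : ℕ) {i j : Fin (n - 3)} (hij : i ≠ j) :
    ∃ p q, a m (tailColumn hn i) = x (tailColumn hn j) * p + y (tailColumn hn j) * q ∧
      a m (tailColumn hn j) = x (tailColumn hn i) * p + y (tailColumn hn i) * q := by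
  have hi : Finset.univ.erase i = insert j ((Finset.univ.erase i).erase j) :=
    (Finset.insert_erase (Finset.mem_erase.2 ⟨hij.symm, Finset.mem_univ j⟩)).symm
  have hj : Finset.univ.erase j = insert i ((Finset.univ.erase i).erase j) := by
    rw [Finset.erase_right_comm]
    exact (Finset.insert_erase (Finset.mem_erase.2 ⟨hij, Finset.mem_univ i⟩)).symm
  have hiT : i ∉ (Finset.univ.erase i).erase j := by simp
  have hjT : j ∉ (Finset.univ.erase i).erase j := Finset.notMem_erase j _
  rw [a_tailColumn, a_tailColumn, hi, hj, coeff_linearProd_insert _ _ hjT,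
    coeff_linearProd_insert _ _ hiT]
  exact ⟨_, _, rfl, rfl⟩

theorem minor_tailColumn_dvd_φ_minor (m : ℕ) {i j : Fin (n - 3)} (hij : i ≠ j) :
    minor (tailColumn hn i) (tailColumn hn j) ∣
      φ hn m (minor (tailColumn hn i) (tailColumn hn j)) := by
  obtain ⟨p, q, hai, haj⟩ := exists_a_tailColumn_eq hn m hij
  rw [φ_minor, φCoeff_tailColumn, φCoeff_tailColumn, hai, haj]
  generalize tailColumn hn i = i, tailColumn hn j = j, headColumn hn 0 = u, headColumn hn 1 = v,
    headColumn hn 2 = w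
  refine Dvd.intro
    (p * (-(x v) * minor w i * minor u j + x i * minor v j * minor w u) +
      q * (-(y v) * minor w i * minor u j + y i * minor v j * minor w u)) ?_
  simp only [minor_eq]
  ring

theorem minor_dvd_φ_minor (m : ℕ) {i j : Fin n} (hij : i < j) :
    minor i j ∣ φ hn m (minor i j) := by
  obtain ⟨i, rfl⟩ | ⟨i, rfl⟩ := eq_headColumn_or_eq_tailColumn hn i <;>
    obtain ⟨j, rfl⟩ | ⟨j, rfl⟩ := eq_headColumn_or_eq_tailColumn hn j
  · simp [φ_minor]
  · exact minor_headColumn_dvd_φ_minor hn m i j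
  · have := headColumn_lt hn j
    have := three_le_tailColumn hn i
    omega
  · exact minor_tailColumn_dvd_φ_minor hn m (ne_of_apply_ne _ hij.ne)

theorem isHomogeneous_φCoeff (m : ℕ) (k : Fin n) : (φCoeff hn m k).IsHomogeneous n := by
  obtain ⟨i, rfl⟩ | ⟨k, rfl⟩ := eq_headColumn_or_eq_tailColumn hn k
  · rw [φCoeff_headColumn]
    exact isHomogeneous_zero _ _ _
  · rw [φCoeff_tailColumn]
    have hcard : (tailWithout (tailColumn hn k)).card + 2 + 2 = n := by
      rw [tailWithout_tailColumn, Finset.card_map, Finset.card_erase_of_mem (Finset.mem_univ k),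
        Finset.card_fin]
      have := k.isLt
      omega
    have hhom := ((isHomogeneous_a m (tailColumn hn k)).mul
      (isHomogeneous_minor (headColumn hn 1) (tailColumn hn k))).mul
      (isHomogeneous_minor (headColumn hn 2) (tailColumn hn k))
    rwa [hcard] at hhom

theorem isHomogeneousField_φ (m : ℕ) : IsHomogeneousField (φ hn m) (n + 1) :=
  isHomogeneousField_iff.2 fun k => by
    rw [φ_x, φ_y]
    exact ⟨(isHomogeneous_φCoeff hn m k).mul (isHomogeneous_x _),
      (isHomogeneous_φCoeff hn m k).mul (isHomogeneous_y _)⟩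

end Phi

section BasisField

/-- The degrees of the fields `basisField`. -/
def fieldDegree (n : ℕ) : Fin 3 ⊕ Fin n ⊕ Fin (n - 3) → ℕ :=
  Sum.elim (fun _ => 1) (Sum.elim (fun _ => 1) fun _ => n + 1)

theorem sum_fieldDegree (hn : 3 ≤ n) : ∑ b, fieldDegree n b = n * (n - 1) := by
  obtain ⟨r, rfl⟩ := Nat.exists_eq_add_of_le' hn
  simp only [fieldDegree, Fintype.sum_sum_type, Sum.elim_inl, Sum.elim_inr, Finset.sum_const,
    Finset.card_univ, Fintype.card_fin, smul_eq_mul, Nat.add_sub_cancel_right, Nat.add_succ_sub_one]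
  ring

variable (hn : 3 ≤ n)

theorem basisField_mem_logDer (G : SimpleGraph (Fin n)) [DecidableRel G.Adj]
    (b : Fin 3 ⊕ Fin n ⊕ Fin (n - 3)) : basisField hn b ∈ logDer (arrangementPoly G) := by
  refine mem_logDer_arrangementPoly_of_forall G fun i j hij _ => ?_
  obtain b | k | m := b
  · fin_cases b
    · exact α_minor i j ▸ dvd_zero _
    · exact β_minor i j ▸ dvd_zero _
    · exact (γ_minor i j).symm.dvd
  · exact Dvd.intro _ (θ_minor k i j).symm
  · exact minor_dvd_φ_minor hn m hij

theorem isHomogeneousField_basisField (b : Fin 3 ⊕ Fin n ⊕ Fin (n - 3)) :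
    IsHomogeneousField (basisField hn b) (fieldDegree n b) := by
  obtain b | k | m := b
  · fin_cases b
    · exact isHomogeneousField_α
    · exact isHomogeneousField_β
    · exact isHomogeneousField_γ
  · exact isHomogeneousField_θ k
  · exact isHomogeneousField_φ hn m

variable {hn} {c : Fin 3 ⊕ Fin n ⊕ Fin (n - 3) → CoordRing n}

theorem sum_smul_basisField_x (k : Fin n) :
    (∑ b, c b • basisField hn b) (x k) = c (.inl 1) * y k + (c (.inr (.inl k)) * x k +
      (∑ m, c (.inr (.inr m)) * φCoeff hn m k) * x (headColumn hn 0)) := by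
  simp [Saito.sum_derivation_apply, Fintype.sum_sum_type, Fin.sum_univ_three, basisField, φ_x,
    Finset.sum_mul, mul_assoc]

theorem sum_smul_basisField_y (k : Fin n) :
    (∑ b, c b • basisField hn b) (y k) = c (.inl 0) * x k + c (.inl 2) * y k +
      (c (.inr (.inl k)) * y k +
        (∑ m, c (.inr (.inr m)) * φCoeff hn m k) * y (headColumn hn 0)) := by
  simp [Saito.sum_derivation_apply, Fintype.sum_sum_type, Fin.sum_univ_three, basisField, φ_y,
    Finset.sum_mul, mul_assoc]

-- In the first three columns the `φₘ` vanish and the `θₖ` are radial, so that `x` times the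
-- `y`-part of the relation minus `y` times its `x`-part involves only the coefficients of `α`, `β`
-- and `γ`, and reads as the vanishing of one binary quadratic form at three independent points.
theorem coeff_αβγ_eq_zero (hc : ∑ b, c b • basisField hn b = 0) (i : Fin 3) :
    c (.inl i) = 0 := by
  have hquadratic : ![-c (.inl 1), c (.inl 2), c (.inl 0)] = 0 := by
    refine eq_zero_of_forall_sum_mul_pow_mul_pow_rev_eq_zero (x := x ∘ headColumn hn)
      (y := y ∘ headColumn hn) (fun k l hkl => ?_) fun k => ?_
    · simpa only [Function.comp_apply, minor_eq] using
        minor_ne_zero ((headColumn hn).injective.ne hkl)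
    · have hx := sum_smul_basisField_x (hn := hn) (c := c) (headColumn hn k)
      have hy := sum_smul_basisField_y (hn := hn) (c := c) (headColumn hn k)
      simp only [hc, Derivation.zero_apply, φCoeff_headColumn, mul_zero, Finset.sum_const_zero,
        zero_mul, add_zero] at hx hy
      have hform : -c (.inl 1) * y (headColumn hn k) ^ 2 +
          c (.inl 2) * (x (headColumn hn k) * y (headColumn hn k)) +
          c (.inl 0) * x (headColumn hn k) ^ 2 = 0 := by
        linear_combination y (headColumn hn k) * hx - x (headColumn hn k) * hy
      simpa [Fin.sum_univ_three, Fin.val_rev] using hform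
  have h (j : Fin 3) := congrFun hquadratic j
  fin_cases i
  · exact h 2
  · exact neg_eq_zero.1 (h 0)
  · exact h 1

theorem coeff_θ_eq_zero_and_sum_φCoeff_eq_zero (hc : ∑ b, c b • basisField hn b = 0) (k : Fin n) :
    c (.inr (.inl k)) = 0 ∧ ∑ m, c (.inr (.inr m)) * φCoeff hn m k = 0 := by
  have hx := sum_smul_basisField_x (hn := hn) (c := c) k
  have hy := sum_smul_basisField_y (hn := hn) (c := c) k
  simp only [hc, Derivation.zero_apply, coeff_αβγ_eq_zero hc, zero_mul, zero_add] at hx hy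
  obtain ⟨i, rfl⟩ | ⟨k, rfl⟩ := eq_headColumn_or_eq_tailColumn hn k
  · simp only [φCoeff_headColumn, mul_zero, Finset.sum_const_zero, zero_mul, add_zero] at hx ⊢
    exact ⟨(mul_eq_zero_iff_right (x_ne_zero _)).1 hx.symm, trivial⟩
  · exact eq_zero_of_mul_add_mul_eq_zero (headColumn_ne_tailColumn hn 0 k).symm hx.symm hy.symm

theorem coeff_φ_eq_zero (hc : ∑ b, c b • basisField hn b = 0) (m : Fin (n - 3)) :
    c (.inr (.inr m)) = 0 := by
  have hdet : (linearProdMatrix (x ∘ tailColumn hn) (y ∘ tailColumn hn)).det ≠ 0 :=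
    det_linearProdMatrix_ne_zero fun k l hkl => by
      simpa only [Function.comp_apply, minor_eq] using
        minor_ne_zero ((tailColumn hn).injective.ne hkl)
  refine congrFun (Matrix.eq_zero_of_mulVec_eq_zero hdet (funext fun k => ?_) :
    (fun m => c (.inr (.inr m))) = 0) m
  have hminors : minor (headColumn hn 1) (tailColumn hn k) *
      minor (headColumn hn 2) (tailColumn hn k) ≠ 0 :=
    mul_ne_zero (minor_ne_zero (headColumn_ne_tailColumn hn 1 k))
      (minor_ne_zero (headColumn_ne_tailColumn hn 2 k))
  refine (mul_eq_zero_iff_right hminors).1 ?_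
  rw [← (coeff_θ_eq_zero_and_sum_φCoeff_eq_zero hc (tailColumn hn k)).2, Matrix.mulVec, dotProduct,
    Finset.sum_mul]
  refine Finset.sum_congr rfl fun m _ => ?_
  rw [φCoeff_tailColumn, a_tailColumn, linearProdMatrix, Matrix.of_apply]
  ring

theorem linearIndependent_basisField : LinearIndependent (CoordRing n) (basisField hn) := by
  refine Fintype.linearIndependent_iff.2 fun c hc b => ?_
  obtain i | k | m := b
  · exact coeff_αβγ_eq_zero hc i
  · exact (coeff_θ_eq_zero_and_sum_φCoeff_eq_zero hc k).1
  · exact coeff_φ_eq_zero hc m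

end BasisField

end DetArr

end

theorem theorem3p3 (n : ℕ) (hn : 3 ≤ n) :
    -- the determinantal arrangement of the complete graph is free
    DetArr.IsFreeDivisor (DetArr.arrangementPoly (⊤ : SimpleGraph (Fin n))) ∧
    -- the explicit fields form a basis of `Der(-log f)`
    (∃ b : Module.Basis (Fin 3 ⊕ Fin n ⊕ Fin (n - 3)) (DetArr.CoordRing n)
        (DetArr.logDer (DetArr.arrangementPoly (⊤ : SimpleGraph (Fin n)))),
      ∀ i, (b i : DetArr.VectorField n) = DetArr.basisField hn i) ∧
    -- degrees: `α, β, γ, θₖ` are linear, the `φₘ` have degree `n + 1`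
    DetArr.IsHomogeneousField (DetArr.α n) 1 ∧
    DetArr.IsHomogeneousField (DetArr.β n) 1 ∧
    DetArr.IsHomogeneousField (DetArr.γ n) 1 ∧
    (∀ k : Fin n, DetArr.IsHomogeneousField (DetArr.θ k) 1) ∧
    (∀ m : Fin (n - 3), DetArr.IsHomogeneousField (DetArr.φ hn m.val) (n + 1)) ∧
    -- Saito's determinant is a nonzero constant multiple of `f`, for an ordering of the fields
    (∃ (e : (Fin n ⊕ Fin n) ≃ (Fin 3 ⊕ Fin n ⊕ Fin (n - 3))) (c : ℂ), c ≠ 0 ∧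
      ((DetArr.coeffMatrix hn).submatrix id e).det =
        MvPolynomial.C c * DetArr.arrangementPoly (⊤ : SimpleGraph (Fin n))) := by
  have e : (Fin n ⊕ Fin n) ≃ (Fin 3 ⊕ Fin n ⊕ Fin (n - 3)) :=
    Fintype.equivOfCardEq (by simp only [Fintype.card_sum, Fintype.card_fin]; omega)
  set f := DetArr.arrangementPoly (⊤ : SimpleGraph (Fin n))
  have hf : Squarefree f := DetArr.squarefree_arrangementPoly ⊤
  have hmem := DetArr.basisField_mem_logDer hn ⊤
  have hlog (v : Fin n ⊕ Fin n) : f ∣ DetArr.basisField hn (e v) f :=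
    DetArr.mem_logDer.1 (hmem (e v))
  have hli := DetArr.linearIndependent_basisField (hn := hn)
  obtain ⟨c, hc, hdet⟩ := Saito.exists_det_coefficientMatrix_eq_C_mul hf hlog
    (hli.comp e e.injective) (fun v => DetArr.isHomogeneousField_basisField hn (e v)) (by
      rw [e.sum_comp, DetArr.sum_fieldDegree hn]
      exact DetArr.isHomogeneous_arrangementPoly_top)
  have hspan : Submodule.span (DetArr.CoordRing n) (Set.range (DetArr.basisField hn)) =
      DetArr.logDer f := by
    refine le_antisymm (Submodule.span_le.2 (Set.range_subset_iff.2 hmem)) fun δ hδ => ?_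
    rw [← e.surjective.range_comp]
    exact Saito.mem_span_range_of_det_eq_mul hf hlog ((isUnit_iff_ne_zero.2 hc).map MvPolynomial.C)
      hdet (DetArr.mem_logDer.1 hδ)
  obtain ⟨b, hb⟩ := Saito.exists_basis_of_span_eq hli hspan
  exact ⟨⟨hf.ne_zero, .of_basis b⟩, ⟨b, hb⟩, DetArr.isHomogeneousField_α,
    DetArr.isHomogeneousField_β, DetArr.isHomogeneousField_γ, DetArr.isHomogeneousField_θ,
    fun m => DetArr.isHomogeneousField_φ hn m, e, c, hc, hdet⟩
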